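/- Let $M$ be a compact Riemannian manifold (smooth, without boundary) of dimension $d$; "almost every" refers to the Lebesgue (Riemannian volume) measure class on $M$, and all norms and determinants of derivatives are taken with respect to the Riemannian metric. For bijections $g_i$ of $M$ indexed by a finite set $I$ and $\omega\in I^{\{0,1,2,\dots\}}$ put $g^0_\omega=\mathrm{id}$ and $g^{n+1}_\omega=g_{\omega_n}\circ g^n_\omega$. A semigroup $G^+\subset \mathrm{Diff}^{1+\alpha}(M)$ is *orbital non-uniformly expanding* if it has a finite generating family $g_1,\dots,g_k$ and a constant $c>0$ such that for almost every $x\in M$ there is $\omega\in\{1,\dots,k\}^{\{0,1,2,\dots\}}$ with $$\limsup_{n\to\infty}\frac1n\sum_{i=0}^{n-1}\log\bigl\|Dg_{\omega_i}(g^i_\omega(x))^{-1}\bigr\|\le -c .$$ **Proposition.** Let $p,q\ge 0$ be integers, $\sigma_1>1$ and $\kappa>q$. There is $\sigma_*>1$, depending only on $M,p,q,\sigma_1,\kappa$, such that the following holds for every $\sigma_2\in(1,\sigma_*]$ and every $\alpha\in(0,1]$. Let $G^+$ be a finitely generated semigroup of $C^{1+\alpha}$ diffeomorphisms of $M$, let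 $f_1,\dots,f_{p+q}\in G^+$, and let $R_1,\dots,R_{p+q}\subset M$ be such that * (A0) $R_1,\dots,R_{p+q}$ is a topological partition of $M$: the $R_i$ are open and pairwise disjoint and their closures cover $M$. There is $L<\infty$ such that, for every $i$, any two points of $\overline{R_i}$ are joined by a curve in $\overline{R_i}$ of length at most $L$; and every boundary $\partial R_i$ has measure zero. * (A1) If $f_i(R_i)\cap R_j\ne\emptyset$, then $f_i(R_i)\supset R_j$. * (A2) $\|Df_i(x)^{-1}\|^{-1}\ge\sigma_1$ for every $x\in R_i$, $1\le i\le p$, and $\|Df_{p+j}(x)^{-1}\|^{-1}\ge\sigma_2^{-1}$ for every $x\in R_{p+j}$, $1\le j\le q$. * (A3) $|\det Df_{p+j}(x)|\ge\kappa$ for every $x\in R_{p+j}$, $1\le j\le q$. Then there is $c>0$ such that almost every $x\in M$ has an itinerary $\omega$, that is, a sequence $\omega\in\{1,\dots,p+q\}^{\{0,1,2,\dots\}}$ with $f^n_\omega(x)\in R_{\omega_n}$ for all $n\ge0$, and $$\limsup_{n\to\infty}\frac1n\sum_{i=0}^{n-1}\log\bigl\|Df_{\omega_i}(f^i_\omega(x))^{-1}\bigr\|\le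 -c .$$ In particular, $G^+$ is orbital non-uniformly expanding. -/

import Mathlib

open Set Filter Topology Bundle Manifold MeasureTheory
open scoped ContDiff NNReal

noncomputable section

/-- The map `f^n_w`: `f^0_w = id` and `f^{n+1}_w = f_{w_n} ∘ f^n_w`. -/
def fiberIterate {X ι : Type*} (f : ι → Equiv.Perm X) (w : ℕ → ι) : ℕ → X → X
  | 0 => fun x => x
  | n + 1 => fun x => f (w n) (fiberIterate f w n x)

/-- `w` is the itinerary of `x` with respect to the family `R` and the maps `f`. -/
def IsItinerary {X ι : Type*} (f : ι → Equiv.Perm X) (R : ι → Set X) (x : X) (w : ℕ → ι) : Prop :=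
  ∀ n, fiberIterate f w n x ∈ R (w n)

/-- A (finite, when `ι` is finite) topological partition of `X`: pairwise disjoint open sets whose
closures cover `X`. -/
structure IsTopologicalPartition {X ι : Type*} [TopologicalSpace X] (R : ι → Set X) : Prop where
  isOpen : ∀ i, IsOpen (R i)
  disjoint : ∀ i j, i ≠ j → R i ∩ R j = ∅
  cover : ⋃ i, closure (R i) = univ

/-- The Markov condition: `f_i(R_i) ∩ R_j ≠ ∅` implies `f_i(R_i) ⊇ R_j`. -/
def IsMarkov {X ι : Type*} (f : ι → Equiv.Perm X) (R : ι → Set X) : Prop :=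
  ∀ i j, (f i '' R i ∩ R j).Nonempty → R j ⊆ f i '' R i

/-- Any two points of `A` are joined by a (continuous) curve contained in `A`, of length at
most `L`. -/
def InnerDiameterLE {X : Type*} [PseudoEMetricSpace X] (A : Set X) (L : ℝ≥0) : Prop :=
  ∀ x ∈ A, ∀ y ∈ A, ∃ γ : ℝ → X, ContinuousOn γ (Icc 0 1) ∧ γ 0 = x ∧ γ 1 = y ∧
    (∀ t ∈ Icc (0 : ℝ) 1, γ t ∈ A) ∧ eVariationOn γ (Icc 0 1) ≤ L

/-- `s` has Lebesgue measure zero in the manifold `M`: its image in every chart is a null set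
of `ℝ^d`. (These are exactly the null sets of the Riemannian volume of `M`, whatever the metric.) -/
def LebesgueNull (d : ℕ) {M : Type*} [TopologicalSpace M]
    [ChartedSpace (EuclideanSpace ℝ (Fin d)) M] (s : Set M) : Prop :=
  ∀ x : M, volume (chartAt (EuclideanSpace ℝ (Fin d)) x ''
    (s ∩ (chartAt (EuclideanSpace ℝ (Fin d)) x).source)) = 0

/-- `P x` holds for Lebesgue almost every `x ∈ M`. -/
def LebesgueAE (d : ℕ) {M : Type*} [TopologicalSpace M]
    [ChartedSpace (EuclideanSpace ℝ (Fin d)) M] (P : M → Prop) : Prop :=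
  LebesgueNull d {x : M | ¬ P x}

/-- Read in charts, the derivative of `f` is locally `α`-Hölder. -/
def HasHolderDeriv (d : ℕ) {M : Type*} [TopologicalSpace M]
    [ChartedSpace (EuclideanSpace ℝ (Fin d)) M] (α : ℝ≥0) (f : M → M) : Prop :=
  ∀ x : M, ∃ C : ℝ≥0, ∃ U ∈ 𝓝 (extChartAt (𝓡 d) x x),
    HolderOnWith C α (fderiv ℝ (writtenInExtChartAt (𝓡 d) (𝓡 d) x f)) U

/-- `f` is a `C^{1+α}` diffeomorphism of `M`. -/
structure IsC1HolderDiffeo (d : ℕ) {M : Type*} [TopologicalSpace M]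
    [ChartedSpace (EuclideanSpace ℝ (Fin d)) M] (α : ℝ≥0) (f : Equiv.Perm M) : Prop where
  contMDiff : ContMDiff (𝓡 d) (𝓡 d) 1 f
  contMDiff_symm : ContMDiff (𝓡 d) (𝓡 d) 1 f.symm
  holder : HasHolderDeriv d α f
  holder_symm : HasHolderDeriv d α f.symm

instance {d : ℕ} {M : Type*} [TopologicalSpace M]
    [ChartedSpace (EuclideanSpace ℝ (Fin d)) M] (x : M) :
    FiniteDimensional ℝ (TangentSpace (𝓡 d) x) :=
  inferInstanceAs (FiniteDimensional ℝ (EuclideanSpace ℝ (Fin d)))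

/-- `|det A|` for a linear map between Euclidean spaces of the same dimension, the determinant
being taken with respect to orthonormal bases; equivalently `√ det (A* A)`. -/
def absDet {V W : Type*} [NormedAddCommGroup V] [InnerProductSpace ℝ V] [FiniteDimensional ℝ V]
    [NormedAddCommGroup W] [InnerProductSpace ℝ W] [FiniteDimensional ℝ W] (A : V →ₗ[ℝ] W) : ℝ :=
  √ (LinearMap.det (LinearMap.adjoint A ∘ₗ A))

/-- `‖Df(x)⁻¹‖`, the operator norm with respect to the Riemannian metric. -/
def normInvDeriv (d : ℕ) {M : Type*} [TopologicalSpace M]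
    [ChartedSpace (EuclideanSpace ℝ (Fin d)) M]
    [RiemannianBundle (fun x : M => TangentSpace (𝓡 d) x)] (f : M → M) (x : M) : ℝ :=
  ‖(mfderiv (𝓡 d) (𝓡 d) f x).inverse‖

/-- `|det Df(x)|`, with respect to the Riemannian metric. -/
def absDetDeriv (d : ℕ) {M : Type*} [TopologicalSpace M]
    [ChartedSpace (EuclideanSpace ℝ (Fin d)) M]
    [RiemannianBundle (fun x : M => TangentSpace (𝓡 d) x)] (f : M → M) (x : M) : ℝ :=
  absDet (mfderiv (𝓡 d) (𝓡 d) f x).toLinearMap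

/-- `limsup_n (1/n) ∑_{i<n} log ‖Df_{w_i}(f^i_w x)⁻¹‖`, as an extended real number. -/
def upperExponent (d : ℕ) {M ι : Type*} [TopologicalSpace M]
    [ChartedSpace (EuclideanSpace ℝ (Fin d)) M]
    [RiemannianBundle (fun x : M => TangentSpace (𝓡 d) x)]
    (f : ι → Equiv.Perm M) (w : ℕ → ι) (x : M) : EReal :=
  limsup (fun n : ℕ => (((1 / (n : ℝ)) * ∑ i ∈ Finset.range n,
    Real.log (normInvDeriv d (f (w i)) (fiberIterate f w i x)) : ℝ) : EReal)) atTop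

/-- The semigroup `G` is orbital non-uniformly expanding, with respect to some finite family of
generators. -/
def IsOrbitalNonUniformlyExpanding (d : ℕ) {M : Type*} [TopologicalSpace M]
    [ChartedSpace (EuclideanSpace ℝ (Fin d)) M]
    [RiemannianBundle (fun x : M => TangentSpace (𝓡 d) x)]
    (G : Subsemigroup (Equiv.Perm M)) : Prop :=
  ∃ (k : ℕ) (g : Fin k → Equiv.Perm M), Subsemigroup.closure (range g) = G ∧
    ∃ c : ℝ, 0 < c ∧ LebesgueAE d fun x : M =>
      ∃ w : ℕ → Fin k, upperExponent d g w x ≤ ((-c : ℝ) : EReal)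

end

/-! The proof is a volume count over words, followed by Borel–Cantelli. Put `l i = 1`, `u i = -log
σ₁` on the first `p` branches and `l i = κ`, `u i = δ` on the other `q`. On `R i`, `l i` bounds the
Jacobian from below and `u i` bounds `log ‖Df⁻¹‖` from above. The points following a word of length
`n` form an open set on which `f^n_w` is injective with Jacobian at least `∏ l (w k)`. Since `M` has
finite volume, that set has volume at most `B / ∏ l (w k)`.

A word is slow if `∑ u (w k) > -c n`. For `s ≥ 0` its indicator is at most `exp (s (∑ u (w k) + c
n))` (Chernoff's trick), so the volumes of all slow words add up to at most `B θ ^ n`, with `θ = ∑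
(l i)⁻¹ exp (s (u i + c))` (`VolumeAtlas.exists_volume_slowSet_le`). As `q / κ < 1`, a large `s`
followed by a small `δ = c` gives `θ < 1` (`exists_expansion_constants`). Hence almost every point
has only finitely many slow times, whichever itinerary it follows
(`VolumeAtlas.ae_eventually_sum_le`). Almost every point has an itinerary, because the preimages of
the null set outside `⋃ R i` are null (`VolumeAtlas.ae_exists_isItinerary`). -/

/-! ### Determinants and operator norms. -/

section LinearAlgebra

variable {U V W : Type*} [NormedAddCommGroup U] [InnerProductSpace ℝ U] [FiniteDimensional ℝ U]
  [NormedAddCommGroup V] [InnerProductSpace ℝ V] [FiniteDimensional ℝ V]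
  [NormedAddCommGroup W] [InnerProductSpace ℝ W] [FiniteDimensional ℝ W]

lemma absDet_eq_normDet (A : U →ₗ[ℝ] V) : absDet A = A.normDet := by
  have h := A.normDet_sq
  simp only [RCLike.ofReal_real_eq_id, id_eq] at h
  rw [absDet, ← h, Real.sqrt_sq A.normDet_nonneg]

lemma absDet_nonneg (A : U →ₗ[ℝ] V) : 0 ≤ absDet A := Real.sqrt_nonneg _

lemma absDet_comp (B : V →ₗ[ℝ] W) (A : U →ₗ[ℝ] V)
    (h : Module.finrank ℝ U = Module.finrank ℝ V) :
    absDet (B ∘ₗ A) = absDet B * absDet A := by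
  simp only [absDet_eq_normDet, LinearMap.normDet_comp_of_finrank_eq A B h]

lemma absDet_eq_abs_det (A : U →ₗ[ℝ] U) : absDet A = |LinearMap.det A| := by
  rw [absDet_eq_normDet, LinearMap.normDet_eq_abs_det]

lemma absDet_id : absDet (LinearMap.id : U →ₗ[ℝ] U) = 1 := by
  rw [absDet_eq_normDet, LinearMap.normDet_id]

/-- The square of a singular value is an eigenvalue of `A* A`, and on its eigenvectors `A` scales
the norm by the singular value. -/
lemma singularValues_le_norm (A : U →L[ℝ] V) {i : ℕ} (hi : i < Module.finrank ℝ U) :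
    A.toLinearMap.singularValues i ≤ ‖A‖ := by
  obtain ⟨v, hv⟩ :=
    (A.toLinearMap.hasEigenvalue_adjoint_comp_self_sq_singularValues hi).exists_hasEigenvector
  have hv0 : 0 < ‖v‖ := norm_pos_iff.2 hv.2
  have h1 : ‖A v‖ ^ 2 = (A.toLinearMap.singularValues i * ‖v‖) ^ 2 := by
    have h2 := hv.apply_eq_smul
    have h3 := congrArg (fun z => inner ℝ z v) h2
    simp only [LinearMap.comp_apply, LinearMap.adjoint_inner_left] at h3
    rw [← real_inner_self_eq_norm_sq, mul_pow, ← real_inner_self_eq_norm_sq v,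
      ← real_inner_smul_left]
    exact h3
  have h4 : ‖A v‖ = A.toLinearMap.singularValues i * ‖v‖ :=
    (sq_eq_sq₀ (norm_nonneg _)
      (mul_nonneg (LinearMap.singularValues_nonneg _ _) (norm_nonneg _))).1 h1
  exact le_of_mul_le_mul_right (h4 ▸ A.le_opNorm v) hv0

lemma absDet_le_norm_pow (A : U →L[ℝ] V) :
    absDet A.toLinearMap ≤ ‖A‖ ^ Module.finrank ℝ U := by
  rw [absDet_eq_normDet, LinearMap.normDet_eq_prod_singularValues]
  calc _ ≤ ∏ i ∈ Finset.range (Module.finrank ℝ U), ‖A‖ := by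
        refine Finset.prod_le_prod (fun i _ => LinearMap.singularValues_nonneg _ _) fun i hi => ?_
        exact singularValues_le_norm A (by simpa using hi)
    _ = _ := by simp

lemma one_le_absDet_of_one_le_inv_norm_inverse (A : U →L[ℝ] V) (h : 1 ≤ ‖A.inverse‖⁻¹) :
    1 ≤ absDet A.toLinearMap := by
  -- A non-invertible map has `inverse` equal to `0`, and `0⁻¹ = 0` in `ℝ`, so the hypothesis forces
  -- invertibility.
  have hA : A.IsInvertible := by
    by_contra hA
    rw [ContinuousLinearMap.inverse_of_not_isInvertible hA] at h
    norm_num at h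
  have h0 : ‖A.inverse‖ ≤ 1 := (one_le_inv₀ (inv_pos.1 (one_pos.trans_le h))).1 h
  obtain ⟨e, rfl⟩ := hA
  have hd : Module.finrank ℝ U = Module.finrank ℝ V := e.toLinearEquiv.finrank_eq
  have h1 := absDet_comp (e : U →L[ℝ] V).inverse.toLinearMap (e : U →L[ℝ] V).toLinearMap hd
  have h2 : (e : U →L[ℝ] V).inverse.toLinearMap ∘ₗ (e : U →L[ℝ] V).toLinearMap
      = LinearMap.id := by
    ext x; simp
  rw [h2, absDet_id] at h1
  have h3 := (absDet_le_norm_pow (e : U →L[ℝ] V).inverse).trans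
    (pow_le_one₀ (norm_nonneg _) h0)
  nlinarith [absDet_nonneg (e : U →L[ℝ] V).toLinearMap]

end LinearAlgebra

/-! ### Derivatives read in charts. -/

section Charts

variable {d : ℕ} {M : Type*} [TopologicalSpace M]
    [ChartedSpace (EuclideanSpace ℝ (Fin d)) M] [IsManifold (𝓡 d) ∞ M]

lemma hasMFDerivAt_chartAt {a y : M} (hy : y ∈ (chartAt (EuclideanSpace ℝ (Fin d)) a).source) :
    HasMFDerivAt (𝓡 d) 𝓘(ℝ, EuclideanSpace ℝ (Fin d)) (chartAt (EuclideanSpace ℝ (Fin d)) a) y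
      ((trivializationAt (EuclideanSpace ℝ (Fin d)) (TangentSpace (𝓡 d)) a).continuousLinearMapAt
        ℝ y) := by
  rw [TangentBundle.continuousLinearMapAt_trivializationAt hy]
  exact (mdifferentiableAt_extChartAt (I := 𝓡 d) hy).hasMFDerivAt

lemma hasMFDerivAt_chartAt_symm {a y : M}
    (hy : y ∈ (chartAt (EuclideanSpace ℝ (Fin d)) a).source) :
    HasMFDerivAt 𝓘(ℝ, EuclideanSpace ℝ (Fin d)) (𝓡 d) (chartAt (EuclideanSpace ℝ (Fin d)) a).symm
      (chartAt (EuclideanSpace ℝ (Fin d)) a y)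
      ((trivializationAt (EuclideanSpace ℝ (Fin d)) (TangentSpace (𝓡 d)) a).symmL ℝ y) := by
  rw [TangentBundle.symmL_trivializationAt hy]
  have h := (mdifferentiableWithinAt_extChartAt_symm (I := 𝓡 d) (x := a)
    (z := extChartAt (𝓡 d) a y) (by simp [hy])).hasMFDerivWithinAt
  simp only [modelWithCornersSelf_coe, range_id, hasMFDerivWithinAt_univ] at h
  simpa using h

lemma hasFDerivAt_chart_conj {g : M → M} {a b y : M}
    (hy : y ∈ (chartAt (EuclideanSpace ℝ (Fin d)) a).source)
    (hgy : g y ∈ (chartAt (EuclideanSpace ℝ (Fin d)) b).source)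
    (hg : MDifferentiableAt (𝓡 d) (𝓡 d) g y) :
    HasFDerivAt (chartAt (EuclideanSpace ℝ (Fin d)) b ∘ g ∘
        (chartAt (EuclideanSpace ℝ (Fin d)) a).symm)
      (((trivializationAt (EuclideanSpace ℝ (Fin d)) (TangentSpace (𝓡 d)) b).continuousLinearMapAt
        ℝ (g y)) ∘L (mfderiv (𝓡 d) (𝓡 d) g y) ∘L
        ((trivializationAt (EuclideanSpace ℝ (Fin d)) (TangentSpace (𝓡 d)) a).symmL ℝ y))
      (chartAt (EuclideanSpace ℝ (Fin d)) a y) := by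
  have e : (chartAt (EuclideanSpace ℝ (Fin d)) a).symm
    (chartAt (EuclideanSpace ℝ (Fin d)) a y) = y := (chartAt _ a).left_inv hy
  have h1 := hasMFDerivAt_chartAt_symm hy
  have h2 : HasMFDerivAt (𝓡 d) (𝓡 d) g ((chartAt (EuclideanSpace ℝ (Fin d)) a).symm
    (chartAt (EuclideanSpace ℝ (Fin d)) a y)) (mfderiv (𝓡 d) (𝓡 d) g y) := by
    rw [e]; exact hg.hasMFDerivAt
  have h3 : HasMFDerivAt (𝓡 d) 𝓘(ℝ, EuclideanSpace ℝ (Fin d))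
    (chartAt (EuclideanSpace ℝ (Fin d)) b) ((g ∘ (chartAt (EuclideanSpace ℝ (Fin d)) a).symm)
    (chartAt (EuclideanSpace ℝ (Fin d)) a y))
    ((trivializationAt (EuclideanSpace ℝ (Fin d)) (TangentSpace (𝓡 d)) b).continuousLinearMapAt
      ℝ (g y)) := by
    simp only [Function.comp_apply]
    rw [e]
    exact hasMFDerivAt_chartAt hgy
  exact (hasMFDerivAt_iff_hasFDerivAt).1 (h3.comp _ (h2.comp _ h1))

end Charts

/-! ### Charts of bounded volume distortion. -/

section Riemannian

variable {d : ℕ} {M : Type*} [TopologicalSpace M]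
    [ChartedSpace (EuclideanSpace ℝ (Fin d)) M] [IsManifold (𝓡 d) ∞ M]
    [RiemannianBundle (fun x : M => TangentSpace (𝓡 d) x)]

omit [IsManifold (𝓡 d) ∞ M] [RiemannianBundle fun x : M => TangentSpace (𝓡 d) x] in
lemma finrank_tangentSpace (y : M) : Module.finrank ℝ (TangentSpace (𝓡 d) y) = d :=
  finrank_euclideanSpace_fin (𝕜 := ℝ) (n := d)

lemma exists_nhd_absDet_trivializationAt_le
    [IsContinuousRiemannianBundle (EuclideanSpace ℝ (Fin d))
      (fun x : M => TangentSpace (𝓡 d) x)] (a : M) :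
    ∃ C : ℝ, 0 < C ∧ ∀ᶠ y in 𝓝 a,
      absDet ((trivializationAt (EuclideanSpace ℝ (Fin d)) (TangentSpace (𝓡 d))
        a).continuousLinearMapAt ℝ y).toLinearMap ≤ C ∧
      absDet ((trivializationAt (EuclideanSpace ℝ (Fin d)) (TangentSpace (𝓡 d))
        a).symmL ℝ y).toLinearMap ≤ C := by
  obtain ⟨C₁, h₁, H₁⟩ := eventually_norm_trivializationAt_lt (EuclideanSpace ℝ (Fin d))
    (fun x : M => TangentSpace (𝓡 d) x) a
  obtain ⟨C₂, h₂, H₂⟩ := eventually_norm_symmL_trivializationAt_lt (EuclideanSpace ℝ (Fin d))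
    (fun x : M => TangentSpace (𝓡 d) x) a
  refine ⟨max (C₁ ^ d) (C₂ ^ d), by positivity, ?_⟩
  filter_upwards [H₁, H₂] with y k₁ k₂
  constructor
  · refine (absDet_le_norm_pow _).trans (le_max_of_le_left ?_)
    rw [finrank_tangentSpace]
    exact pow_le_pow_left₀ (norm_nonneg _) k₁.le _
  · refine (absDet_le_norm_pow _).trans (le_max_of_le_right ?_)
    rw [finrank_euclideanSpace_fin]
    exact pow_le_pow_left₀ (norm_nonneg _) k₂.le _

variable (d M) in
/-- A finite cover of a compact Riemannian manifold by chart domains of finite volume, on which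
the chart distorts volume by at most a factor `C`. -/
structure VolumeAtlas where
  /-- The centers of the charts. -/
  centers : Finset M
  /-- The domains. -/
  dom : M → Set M
  /-- The distortion bound. -/
  C : ℝ
  C_pos : 0 < C
  isOpen_dom : ∀ a, IsOpen (dom a)
  dom_subset : ∀ a, dom a ⊆ (chartAt (EuclideanSpace ℝ (Fin d)) a).source
  cover : ∀ y, ∃ a ∈ centers, y ∈ dom a
  volume_lt_top : ∀ a, volume (chartAt (EuclideanSpace ℝ (Fin d)) a '' dom a) < ⊤
  absDet_le : ∀ a ∈ centers, ∀ y ∈ dom a,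
    absDet ((trivializationAt (EuclideanSpace ℝ (Fin d)) (TangentSpace (𝓡 d))
      a).continuousLinearMapAt ℝ y).toLinearMap ≤ C
  absDet_symmL_le : ∀ a ∈ centers, ∀ y ∈ dom a,
    absDet ((trivializationAt (EuclideanSpace ℝ (Fin d)) (TangentSpace (𝓡 d))
      a).symmL ℝ y).toLinearMap ≤ C

lemma nonempty_volumeAtlas [CompactSpace M]
    [IsContinuousRiemannianBundle (EuclideanSpace ℝ (Fin d))
      (fun x : M => TangentSpace (𝓡 d) x)] : Nonempty (VolumeAtlas d M) := by
  choose C hC H using fun a : M => exists_nhd_absDet_trivializationAt_le (d := d) a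
  let φ := fun a : M => chartAt (EuclideanSpace ℝ (Fin d)) a
  let K : M → Set M := fun a => interior {y | absDet ((trivializationAt (EuclideanSpace ℝ (Fin d))
      (TangentSpace (𝓡 d)) a).continuousLinearMapAt ℝ y).toLinearMap ≤ C a ∧
      absDet ((trivializationAt (EuclideanSpace ℝ (Fin d)) (TangentSpace (𝓡 d))
        a).symmL ℝ y).toLinearMap ≤ C a} ∩ ((φ a).source ∩ φ a ⁻¹' Metric.ball (φ a a) 1)
  have hK : ∀ a, IsOpen (K a) := fun a =>
    isOpen_interior.inter ((φ a).isOpen_inter_preimage Metric.isOpen_ball)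
  have haK : ∀ a, a ∈ K a := fun a =>
    ⟨mem_interior_iff_mem_nhds.2 (H a), mem_chart_source _ a, Metric.mem_ball_self one_pos⟩
  obtain ⟨s, hs⟩ := isCompact_univ.elim_finite_subcover K hK
    (fun a _ => mem_iUnion.2 ⟨a, haK a⟩)
  -- The sum dominates every `C a` at once; the summand `1` keeps it positive when the cover is
  -- empty.
  refine ⟨⟨s, K, 1 + ∑ a ∈ s, C a, ?_, hK, fun a y hy => hy.2.1, fun y => ?_, fun a => ?_, ?_, ?_⟩⟩
  · have := Finset.sum_nonneg fun a (_ : a ∈ s) => (hC a).le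
    linarith
  · simpa using hs (mem_univ y)
  · refine (measure_mono ?_).trans_lt (measure_ball_lt_top (x := φ a a) (r := 1))
    rintro _ ⟨y, hy, rfl⟩
    exact hy.2.2
  · intro a ha y hy
    have := Finset.single_le_sum (fun b _ => (hC b).le) ha
    linarith [(interior_subset hy.1).1]
  · intro a ha y hy
    have := Finset.single_le_sum (fun b _ => (hC b).le) ha
    linarith [(interior_subset hy.1).2]

/-- The derivative is its chart expression composed with two trivialization maps, each costing one
factor `C`. -/
lemma VolumeAtlas.absDetDeriv_le (K : VolumeAtlas d M) {a b : M} (ha : a ∈ K.centers)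
    (hb : b ∈ K.centers) {g : M → M} {y : M} (hy : y ∈ K.dom a) (hgy : g y ∈ K.dom b) :
    absDetDeriv d g y ≤ K.C ^ 2 *
      |(((trivializationAt (EuclideanSpace ℝ (Fin d)) (TangentSpace (𝓡 d)) b).continuousLinearMapAt
        ℝ (g y)) ∘L (mfderiv (𝓡 d) (𝓡 d) g y) ∘L
        ((trivializationAt (EuclideanSpace ℝ (Fin d)) (TangentSpace (𝓡 d)) a).symmL ℝ y)).det| := by
  set F : EuclideanSpace ℝ (Fin d) →L[ℝ] EuclideanSpace ℝ (Fin d) :=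
    (((trivializationAt (EuclideanSpace ℝ (Fin d)) (TangentSpace (𝓡 d)) b).continuousLinearMapAt
        ℝ (g y)) ∘L (mfderiv (𝓡 d) (𝓡 d) g y) ∘L
        ((trivializationAt (EuclideanSpace ℝ (Fin d)) (TangentSpace (𝓡 d)) a).symmL ℝ y)) with hF
  have h : (mfderiv (𝓡 d) (𝓡 d) g y).toLinearMap =
      ((trivializationAt (EuclideanSpace ℝ (Fin d)) (TangentSpace (𝓡 d)) b).symmL ℝ
        (g y)).toLinearMap ∘ₗ (F.toLinearMap ∘ₗ
      ((trivializationAt (EuclideanSpace ℝ (Fin d)) (TangentSpace (𝓡 d))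
        a).continuousLinearMapAt ℝ y).toLinearMap) := by
    ext v
    have h1 := (trivializationAt (EuclideanSpace ℝ (Fin d)) (TangentSpace (𝓡 d))
      b).symmL_continuousLinearMapAt (R := ℝ) (b := g y)
      (by simpa using K.dom_subset b hgy)
    have h2 := (trivializationAt (EuclideanSpace ℝ (Fin d)) (TangentSpace (𝓡 d))
      a).symmL_continuousLinearMapAt (R := ℝ) (b := y)
      (by simpa using K.dom_subset a hy)
    simp only [hF, LinearMap.comp_apply, ContinuousLinearMap.coe_coe,
      ContinuousLinearMap.comp_apply]
    rw [h1, h2]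
  have e1 := finrank_tangentSpace (d := d) y
  have e2 := finrank_euclideanSpace_fin (𝕜 := ℝ) (n := d)
  rw [absDetDeriv, h, absDet_comp _ _ (e1.trans e2.symm), absDet_comp _ _ (e1.trans e2.symm),
    absDet_eq_abs_det]
  have k1 := K.absDet_symmL_le b hb _ hgy
  have k2 := K.absDet_le a ha _ hy
  have k3 := absDet_nonneg ((trivializationAt (EuclideanSpace ℝ (Fin d)) (TangentSpace (𝓡 d))
        a).continuousLinearMapAt ℝ y).toLinearMap
  calc _ ≤ K.C * (|LinearMap.det F.toLinearMap| * K.C) := by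
        gcongr
        exact K.C_pos.le
    _ = _ := by rw [ContinuousLinearMap.det]; ring

end Riemannian

/-! ### Change of variables and null sets. -/

section Volume

variable {d : ℕ} {M : Type*} [TopologicalSpace M]
    [ChartedSpace (EuclideanSpace ℝ (Fin d)) M] [IsManifold (𝓡 d) ∞ M]
    [RiemannianBundle (fun x : M => TangentSpace (𝓡 d) x)]

/-- Change of variables for the chart expression of `g`: it is injective, so the integral of its
Jacobian is the volume of an image contained in `ψ '' K.dom b`. -/
lemma VolumeAtlas.ofReal_mul_volume_le_of_preimage (K : VolumeAtlas d M) {a b : M}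
    (ha : a ∈ K.centers) (hb : b ∈ K.centers) {g : M → M} (hg : MDifferentiable (𝓡 d) (𝓡 d) g)
    (hinj : Function.Injective g) {A : Set M} (hA : IsOpen A) {D : ℝ}
    (hD : ∀ y ∈ A, D ≤ absDetDeriv d g y) :
    ENNReal.ofReal D * volume (chartAt (EuclideanSpace ℝ (Fin d)) a ''
        (A ∩ K.dom a ∩ g ⁻¹' K.dom b)) ≤
      ENNReal.ofReal (K.C ^ 2) * volume (chartAt (EuclideanSpace ℝ (Fin d)) b '' K.dom b) := by
  set φ := chartAt (EuclideanSpace ℝ (Fin d)) a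
  set ψ := chartAt (EuclideanSpace ℝ (Fin d)) b
  set S := A ∩ K.dom a ∩ g ⁻¹' K.dom b with hS
  have hSs : S ⊆ φ.source := fun y hy => K.dom_subset a hy.1.2
  have hSo : IsOpen S :=
    (hA.inter (K.isOpen_dom a)).inter ((K.isOpen_dom b).preimage hg.continuous)
  have hTm : MeasurableSet (φ '' S) := (φ.isOpen_image_of_subset_source hSo hSs).measurableSet
  let h := ψ ∘ g ∘ φ.symm
  have hd : ∀ z ∈ φ '' S, HasFDerivWithinAt h (fderiv ℝ h z) (φ '' S) z := by
    rintro _ ⟨y, hy, rfl⟩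
    exact (hasFDerivAt_chart_conj (hSs hy) (K.dom_subset b hy.2)
      (hg y)).differentiableAt.hasFDerivAt.hasFDerivWithinAt
  have hφ : ∀ y ∈ S, φ.symm (φ y) = y := fun y hy => φ.left_inv (hSs hy)
  have hi : InjOn h (φ '' S) := by
    rintro _ ⟨y, hy, rfl⟩ _ ⟨z, hz, rfl⟩ e
    simp only [h, Function.comp_apply, hφ y hy, hφ z hz] at e
    rw [hinj (ψ.injOn (K.dom_subset b hy.2) (K.dom_subset b hz.2) e)]
  have himg : h '' (φ '' S) ⊆ ψ '' K.dom b := by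
    rintro _ ⟨_, ⟨y, hy, rfl⟩, rfl⟩
    exact ⟨g y, hy.2, by simp only [h, Function.comp_apply, hφ y hy]⟩
  calc ENNReal.ofReal D * volume (φ '' S) = ∫⁻ _ in φ '' S, ENNReal.ofReal D := by simp
    _ ≤ ∫⁻ z in φ '' S, ENNReal.ofReal (K.C ^ 2) * ENNReal.ofReal |(fderiv ℝ h z).det| := by
        refine setLIntegral_mono' hTm ?_
        rintro _ ⟨y, hy, rfl⟩
        rw [← ENNReal.ofReal_mul (by positivity)]
        refine ENNReal.ofReal_le_ofReal ((hD y hy.1.1).trans ?_)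
        rw [(hasFDerivAt_chart_conj (hSs hy) (K.dom_subset b hy.2) (hg y)).fderiv]
        exact K.absDetDeriv_le ha hb hy.1.2 hy.2
    _ = ENNReal.ofReal (K.C ^ 2) * ∫⁻ z in φ '' S, ENNReal.ofReal |(fderiv ℝ h z).det| :=
        lintegral_const_mul' _ _ ENNReal.ofReal_ne_top
    _ = ENNReal.ofReal (K.C ^ 2) * volume (h '' (φ '' S)) := by
        rw [lintegral_abs_det_fderiv_eq_addHaar_image volume hTm hd hi]
    _ ≤ _ := by gcongr

lemma VolumeAtlas.ofReal_mul_volume_le (K : VolumeAtlas d M) {a : M}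
    (ha : a ∈ K.centers) {g : M → M} (hg : MDifferentiable (𝓡 d) (𝓡 d) g)
    (hinj : Function.Injective g) {A : Set M} (hA : IsOpen A) {D : ℝ}
    (hD : ∀ y ∈ A, D ≤ absDetDeriv d g y) :
    ENNReal.ofReal D * volume (chartAt (EuclideanSpace ℝ (Fin d)) a '' (A ∩ K.dom a)) ≤
      ENNReal.ofReal (K.C ^ 2) *
        ∑ b ∈ K.centers, volume (chartAt (EuclideanSpace ℝ (Fin d)) b '' K.dom b) := by
  have hsub : chartAt (EuclideanSpace ℝ (Fin d)) a '' (A ∩ K.dom a) ⊆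
      ⋃ b ∈ K.centers, chartAt (EuclideanSpace ℝ (Fin d)) a ''
        (A ∩ K.dom a ∩ g ⁻¹' K.dom b) := by
    rintro _ ⟨y, hy, rfl⟩
    obtain ⟨b, hb, hgb⟩ := K.cover (g y)
    exact mem_biUnion hb ⟨y, ⟨hy, hgb⟩, rfl⟩
  calc _ ≤ ENNReal.ofReal D * ∑ b ∈ K.centers, volume (chartAt (EuclideanSpace ℝ (Fin d)) a ''
        (A ∩ K.dom a ∩ g ⁻¹' K.dom b)) := by
        gcongr
        exact (measure_mono hsub).trans (measure_biUnion_finset_le _ _)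
    _ ≤ _ := by
        rw [Finset.mul_sum, Finset.mul_sum]
        exact Finset.sum_le_sum fun b hb =>
          K.ofReal_mul_volume_le_of_preimage ha hb hg hinj hA hD

/-- Differentiable maps of `ℝ^d` send null sets to null sets. With `g = id` this shows that the
finitely many domains of the atlas suffice to test nullity. -/
lemma VolumeAtlas.lebesgueNull_image (K : VolumeAtlas d M) {g : M → M}
    (hg : MDifferentiable (𝓡 d) (𝓡 d) g) {s : Set M}
    (hs : ∀ a ∈ K.centers, volume (chartAt (EuclideanSpace ℝ (Fin d)) a '' (s ∩ K.dom a)) = 0) :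
    LebesgueNull d (g '' s) := by
  intro b
  set ψ := chartAt (EuclideanSpace ℝ (Fin d)) b
  let T : M → Set (EuclideanSpace ℝ (Fin d)) := fun a =>
    chartAt (EuclideanSpace ℝ (Fin d)) a '' (s ∩ K.dom a ∩ g ⁻¹' ψ.source)
  let h : M → EuclideanSpace ℝ (Fin d) → EuclideanSpace ℝ (Fin d) := fun a =>
    ψ ∘ g ∘ (chartAt (EuclideanSpace ℝ (Fin d)) a).symm
  have hsub : ψ '' (g '' s ∩ ψ.source) ⊆ ⋃ a ∈ K.centers, h a '' T a := by
    rintro _ ⟨_, ⟨⟨y, hy, rfl⟩, hgy⟩, rfl⟩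
    obtain ⟨a, ha, hya⟩ := K.cover y
    refine mem_biUnion ha ⟨_, ⟨y, ⟨⟨hy, hya⟩, hgy⟩, rfl⟩, ?_⟩
    simp only [h, Function.comp_apply, (chartAt _ a).left_inv (K.dom_subset a hya)]
  refine measure_mono_null hsub ((measure_biUnion_null_iff K.centers.countable_toSet).2
    fun a ha => ?_)
  refine addHaar_image_eq_zero_of_differentiableOn_of_addHaar_eq_zero volume ?_
    (measure_mono_null (image_mono inter_subset_left) (hs a ha))
  rintro _ ⟨y, hy, rfl⟩
  exact (hasFDerivAt_chart_conj (K.dom_subset a hy.1.2) hy.2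
    (hg y)).differentiableAt.differentiableWithinAt

lemma VolumeAtlas.lebesgueNull_of_forall (K : VolumeAtlas d M) {s : Set M}
    (hs : ∀ a ∈ K.centers, volume (chartAt (EuclideanSpace ℝ (Fin d)) a '' (s ∩ K.dom a)) = 0) :
    LebesgueNull d s := by
  simpa using K.lebesgueNull_image (mdifferentiable_id (I := 𝓡 d)) hs

lemma LebesgueNull.image (K : VolumeAtlas d M) {g : M → M}
    (hg : MDifferentiable (𝓡 d) (𝓡 d) g) {s : Set M} (hs : LebesgueNull d s) :
    LebesgueNull d (g '' s) :=
  K.lebesgueNull_image hg fun a _ => measure_mono_null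
    (image_mono (inter_subset_inter_right s (K.dom_subset a))) (hs a)

omit [IsManifold (𝓡 d) ∞ M] [RiemannianBundle fun x : M => TangentSpace (𝓡 d) x] in
lemma LebesgueNull.mono {s t : Set M} (h : s ⊆ t) (ht : LebesgueNull d t) : LebesgueNull d s :=
  fun a => measure_mono_null (image_mono (inter_subset_inter_left _ h)) (ht a)

omit [IsManifold (𝓡 d) ∞ M] [RiemannianBundle fun x : M => TangentSpace (𝓡 d) x] in
lemma LebesgueNull.union {s t : Set M} (hs : LebesgueNull d s) (ht : LebesgueNull d t) :
    LebesgueNull d (s ∪ t) := by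
  intro a
  rw [union_inter_distrib_right, image_union]
  exact measure_union_null (hs a) (ht a)

omit [IsManifold (𝓡 d) ∞ M] [RiemannianBundle fun x : M => TangentSpace (𝓡 d) x] in
lemma LebesgueNull.iUnion {ι : Type*} [Countable ι] {s : ι → Set M}
    (h : ∀ i, LebesgueNull d (s i)) : LebesgueNull d (⋃ i, s i) := by
  intro a
  rw [iUnion_inter, image_iUnion]
  exact measure_iUnion_null fun i => h i a

end Volume

/-! ### Words, orbits and itineraries. -/

section FiberIterate

variable {X ι : Type*}

lemma fiberIterate_congr (f : ι → Equiv.Perm X) {w w' : ℕ → ι} {n : ℕ}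
    (h : ∀ k < n, w k = w' k) : fiberIterate f w n = fiberIterate f w' n := by
  induction n with
  | zero => rfl
  | succ n ih =>
    funext x
    simp only [fiberIterate]
    rw [ih fun k hk => h k (by omega), h n (by omega)]

lemma fiberIterate_injective (f : ι → Equiv.Perm X) (w : ℕ → ι) (n : ℕ) :
    Function.Injective (fiberIterate f w n) := by
  induction n with
  | zero => exact fun x y h => h
  | succ n ih => exact (f (w n)).injective.comp ih

/-- The points which follow the first `n` symbols of `w`. -/
def followSet (f : ι → Equiv.Perm X) (R : ι → Set X) (w : ℕ → ι) (n : ℕ) : Set X :=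
  {x | ∀ k < n, fiberIterate f w k x ∈ R (w k)}

lemma followSet_congr (f : ι → Equiv.Perm X) (R : ι → Set X) {w w' : ℕ → ι} {n : ℕ}
    (h : ∀ k < n, w k = w' k) : followSet f R w n = followSet f R w' n := by
  ext x
  refine forall₂_congr fun k hk => ?_
  rw [fiberIterate_congr f fun l hl => h l (hl.trans hk), h k hk]

lemma exists_isItinerary_of_forward_invariant {f : ι → Equiv.Perm X}
    {R : ι → Set X} {Y : Set X}
    (hY : ∀ x ∈ Y, ∀ i, f i x ∈ Y) (hYR : Y ⊆ ⋃ i, R i)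
    {x : X} (hx : x ∈ Y) :
    ∃ w, IsItinerary f R x w := by
  choose j hj using fun y : Y => mem_iUnion.1 (hYR y.2)
  let o : ℕ → Y := fun n => Nat.rec ⟨x, hx⟩ (fun _ y => ⟨f (j y) y, hY y y.2 _⟩) n
  have h : ∀ n, fiberIterate f (fun n => j (o n)) n x = (o n).1 := by
    intro n
    induction n with
    | zero => rfl
    | succ n ih => exact congrArg (f (j (o n))) ih
  exact ⟨fun n => j (o n), fun n => by rw [h]; exact hj _⟩

end FiberIterate

/-! ### Volume of slow words and almost sure itineraries. -/

section Dynamics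

variable {d : ℕ} {M : Type*} [TopologicalSpace M]
    [ChartedSpace (EuclideanSpace ℝ (Fin d)) M] {ι : Type*} {f : ι → Equiv.Perm M}

lemma mdifferentiable_fiberIterate (hf : ∀ i, MDifferentiable (𝓡 d) (𝓡 d) (f i))
    (w : ℕ → ι) (n : ℕ) : MDifferentiable (𝓡 d) (𝓡 d) (fiberIterate f w n) := by
  induction n with
  | zero => exact mdifferentiable_id
  | succ n ih => exact (hf (w n)).comp ih

lemma isOpen_followSet (hf : ∀ i, MDifferentiable (𝓡 d) (𝓡 d) (f i)) {R : ι → Set M}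
    (hR : ∀ i, IsOpen (R i)) (w : ℕ → ι) (n : ℕ) : IsOpen (followSet f R w n) := by
  have h : followSet f R w n = ⋂ k ∈ Finset.range n, fiberIterate f w k ⁻¹' R (w k) := by
    ext x
    simp [followSet]
  rw [h]
  exact isOpen_biInter_finset fun k _ =>
    (hR (w k)).preimage (mdifferentiable_fiberIterate hf w k).continuous

variable [RiemannianBundle (fun x : M => TangentSpace (𝓡 d) x)]

lemma absDetDeriv_comp {g h : M → M} {x : M} (hg : MDifferentiableAt (𝓡 d) (𝓡 d) g (h x))
    (hh : MDifferentiableAt (𝓡 d) (𝓡 d) h x) :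
    absDetDeriv d (g ∘ h) x = absDetDeriv d g (h x) * absDetDeriv d h x := by
  have e := (finrank_tangentSpace (d := d) x).trans (finrank_tangentSpace (h x)).symm
  rw [absDetDeriv, mfderiv_comp x hg hh]
  exact absDet_comp _ _ e

lemma prod_le_absDetDeriv_fiberIterate (hf : ∀ i, MDifferentiable (𝓡 d) (𝓡 d) (f i))
    {R : ι → Set M} {l : ι → ℝ} (hl : ∀ i, 0 < l i)
    (hdet : ∀ i, ∀ x ∈ R i, l i ≤ absDetDeriv d (f i) x) {w : ℕ → ι} {n : ℕ} {x : M}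
    (hx : x ∈ followSet f R w n) :
    ∏ k ∈ Finset.range n, l (w k) ≤ absDetDeriv d (fiberIterate f w n) x := by
  induction n with
  | zero =>
    have h : absDetDeriv d (fiberIterate f w 0) x = 1 := by
      have : fiberIterate f w 0 = id := rfl
      rw [absDetDeriv, this, mfderiv_id]
      exact absDet_id
    simp [h]
  | succ n ih =>
    have h : fiberIterate f w (n + 1) = f (w n) ∘ fiberIterate f w n := rfl
    rw [h, absDetDeriv_comp (hf (w n) _) (mdifferentiable_fiberIterate hf w n x),
      Finset.prod_range_succ, mul_comm]
    exact mul_le_mul (hdet _ _ (hx n (by omega))) (ih fun k hk => hx k (by omega))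
      (Finset.prod_nonneg fun k _ => (hl _).le) (absDet_nonneg _)

variable [IsManifold (𝓡 d) ∞ M]

/-- The points having, up to time `n`, an itinerary along which the sum of `u` exceeds `-c n`. -/
def slowSet (f : ι → Equiv.Perm M) (R : ι → Set M) (u : ι → ℝ) (c : ℝ) (n : ℕ) : Set M :=
  {x | ∃ w : ℕ → ι, x ∈ followSet f R w n ∧ -c * n < ∑ k ∈ Finset.range n, u (w k)}

/-- `B` bounds the total volume, distortion included, and is independent of `n`; `θ ^ n` is the
weighted count of words of length `n`. -/
lemma VolumeAtlas.exists_volume_slowSet_le [Finite ι] [Nonempty ι] (K : VolumeAtlas d M)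
    (hf : ∀ i, MDifferentiable (𝓡 d) (𝓡 d) (f i))
    {R : ι → Set M} (hR : ∀ i, IsOpen (R i)) {l : ι → ℝ} (hl : ∀ i, 0 < l i)
    (hdet : ∀ i, ∀ x ∈ R i, l i ≤ absDetDeriv d (f i) x) (u : ι → ℝ) {s : ℝ} (hs : 0 ≤ s)
    (c : ℝ) {θ : ℝ} (hθ : ∑ᶠ i, (l i)⁻¹ * Real.exp (s * (u i + c)) = θ) :
    ∃ B : ENNReal, B ≠ ⊤ ∧ ∀ a ∈ K.centers, ∀ n,
      volume (chartAt (EuclideanSpace ℝ (Fin d)) a '' (slowSet f R u c n ∩ K.dom a)) ≤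
        B * ENNReal.ofReal θ ^ n := by
  classical
  cases nonempty_fintype ι
  rw [finsum_eq_sum_of_fintype] at hθ
  refine ⟨ENNReal.ofReal (K.C ^ 2) *
    ∑ b ∈ K.centers, volume (chartAt (EuclideanSpace ℝ (Fin d)) b '' K.dom b),
    ENNReal.mul_ne_top ENNReal.ofReal_ne_top
      (ENNReal.sum_lt_top.2 fun b _ => K.volume_lt_top b).ne, fun a ha n => ?_⟩
  set B := ENNReal.ofReal (K.C ^ 2) *
    ∑ b ∈ K.centers, volume (chartAt (EuclideanSpace ℝ (Fin d)) b '' K.dom b)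
  let r : ι → ℝ := fun i => (l i)⁻¹ * Real.exp (s * (u i + c))
  have hr : ∀ i, 0 ≤ r i := fun i => mul_nonneg (inv_nonneg.2 (hl i).le) (Real.exp_pos _).le
  -- Only the first `n` symbols matter, so infinite words reduce to finitely many padded ones.
  let ext : (Fin n → ι) → ℕ → ι := fun v k =>
    if h : k < n then v ⟨k, h⟩ else Classical.arbitrary ι
  have hext : ∀ v (k : Fin n), ext v k = v k := fun v k => by simp [ext]
  let T : (Fin n → ι) → Set M := fun v =>
    {x | x ∈ followSet f R (ext v) n ∧ -c * n < ∑ k ∈ Finset.range n, u (ext v k)}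
  have hsub : chartAt (EuclideanSpace ℝ (Fin d)) a '' (slowSet f R u c n ∩ K.dom a) ⊆
      ⋃ v : Fin n → ι, chartAt (EuclideanSpace ℝ (Fin d)) a '' (T v ∩ K.dom a) := by
    rintro _ ⟨x, ⟨⟨w, hw, hwu⟩, hx⟩, rfl⟩
    refine mem_iUnion.2 ⟨fun k => w k, x, ⟨?_, hx⟩, rfl⟩
    have e : ∀ k < n, w k = ext (fun k => w k) k := fun k hk => by simp [ext, hk]
    refine ⟨followSet_congr f R e ▸ hw, hwu.trans_eq ?_⟩
    exact Finset.sum_congr rfl fun k hk => by rw [← e k (Finset.mem_range.1 hk)]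
  have hT : ∀ v, volume (chartAt (EuclideanSpace ℝ (Fin d)) a '' (T v ∩ K.dom a)) ≤
      B * ENNReal.ofReal (∏ k, r (v k)) := by
    intro v
    by_cases hv : -c * n < ∑ k ∈ Finset.range n, u (ext v k)
    · set D := ∏ k ∈ Finset.range n, l (ext v k) with hDdef
      have hD : 0 < D := Finset.prod_pos fun k _ => hl _
      have h1 := K.ofReal_mul_volume_le ha (mdifferentiable_fiberIterate hf (ext v) n)
        (fiberIterate_injective f (ext v) n) (isOpen_followSet hf hR (ext v) n)
        fun y hy => prod_le_absDetDeriv_fiberIterate hf hl hdet hy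
      -- Chernoff's trick: the exponential factor is at least `1` on a slow word.
      have h2 : D⁻¹ ≤ ∏ k, r (v k) := by
        have h3 : ∏ k, r (v k) =
            D⁻¹ * Real.exp (s * (∑ k ∈ Finset.range n, u (ext v k) + c * n)) := by
          rw [hDdef, Finset.prod_range, Finset.sum_range, ← Finset.prod_inv_distrib]
          simp only [hext, r]
          rw [Finset.prod_mul_distrib, ← Real.exp_sum, ← Finset.mul_sum, Finset.sum_add_distrib]
          simp [mul_comm]
        rw [h3]
        refine le_mul_of_one_le_right (inv_pos.2 hD).le (Real.one_le_exp (mul_nonneg hs ?_))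
        linarith
      have h4 : T v ⊆ followSet f R (ext v) n := fun x hx => hx.1
      calc _ ≤ volume (chartAt (EuclideanSpace ℝ (Fin d)) a ''
            (followSet f R (ext v) n ∩ K.dom a)) :=
            measure_mono (image_mono (inter_subset_inter_left _ h4))
        _ = ENNReal.ofReal D⁻¹ * (ENNReal.ofReal D * volume (chartAt (EuclideanSpace ℝ (Fin d)) a ''
            (followSet f R (ext v) n ∩ K.dom a))) := by
            rw [← mul_assoc, ← ENNReal.ofReal_mul (inv_pos.2 hD).le, inv_mul_cancel₀ hD.ne']
            simp
        _ ≤ ENNReal.ofReal (∏ k, r (v k)) * B := by gcongr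
        _ = _ := mul_comm _ _
    · have : T v = ∅ := by
        ext x
        simp only [T, mem_ofPred_eq, mem_empty_iff_false, iff_false, not_and]
        exact fun _ => hv
      simp [this]
  calc _ ≤ ∑ v, volume (chartAt (EuclideanSpace ℝ (Fin d)) a '' (T v ∩ K.dom a)) :=
        (measure_mono hsub).trans (measure_iUnion_fintype_le _ _)
    _ ≤ ∑ v : Fin n → ι, B * ENNReal.ofReal (∏ k, r (v k)) := Finset.sum_le_sum fun v _ => hT v
    _ = B * ENNReal.ofReal θ ^ n := by
        -- The weights are multiplicative along words, so their sum is the expansion of `θ ^ n`.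
        rw [← Finset.mul_sum, ← ENNReal.ofReal_sum_of_nonneg
          (fun v _ => Finset.prod_nonneg fun k _ => hr _), ← Fintype.sum_pow, hθ,
          ENNReal.ofReal_pow]
        rw [← hθ]
        exact Finset.sum_nonneg fun i _ => hr i

/-- Borel–Cantelli in each chart: the geometric bounds are summable because `θ < 1`. -/
lemma VolumeAtlas.ae_eventually_sum_le [Finite ι] (K : VolumeAtlas d M)
    (hf : ∀ i, MDifferentiable (𝓡 d) (𝓡 d) (f i))
    {R : ι → Set M} (hR : ∀ i, IsOpen (R i)) {l : ι → ℝ} (hl : ∀ i, 0 < l i)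
    (hdet : ∀ i, ∀ x ∈ R i, l i ≤ absDetDeriv d (f i) x) (u : ι → ℝ) {s : ℝ} (hs : 0 ≤ s)
    (c : ℝ) (hθ : ∑ᶠ i, (l i)⁻¹ * Real.exp (s * (u i + c)) < 1) :
    LebesgueAE d fun x : M => ∀ w, IsItinerary f R x w →
      ∀ᶠ n : ℕ in atTop, ∑ k ∈ Finset.range n, u (w k) ≤ -c * n := by
  refine K.lebesgueNull_of_forall fun a ha => ?_
  cases isEmpty_or_nonempty ι
  · simp
  obtain ⟨B, hB, h⟩ := K.exists_volume_slowSet_le hf hR hl hdet u hs c rfl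
  have hsum : ∑' n, volume {z | z ∈ chartAt (EuclideanSpace ℝ (Fin d)) a ''
      (slowSet f R u c n ∩ K.dom a)} ≠ ⊤ := by
    refine ne_top_of_le_ne_top ?_ (ENNReal.tsum_le_tsum fun n => h a ha n)
    rw [ENNReal.tsum_mul_left, ENNReal.tsum_geometric]
    refine ENNReal.mul_ne_top hB (ENNReal.inv_ne_top.2 ?_)
    rw [ne_eq, tsub_eq_zero_iff_le, not_le]
    simpa using hθ
  refine measure_mono_null ?_ (measure_setOfPred_frequently_eq_zero hsum)
  rintro _ ⟨x, ⟨hx, hxa⟩, rfl⟩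
  simp only [mem_ofPred_eq, not_forall] at hx
  obtain ⟨w, hw, hn⟩ := hx
  exact (not_eventually.1 hn).mono fun n hn =>
    ⟨x, ⟨⟨w, fun k _ => hw k, not_le.1 hn⟩, hxa⟩, rfl⟩

lemma VolumeAtlas.ae_exists_isItinerary [Finite ι] (K : VolumeAtlas d M)
    (hf : ∀ i, MDifferentiable (𝓡 d) (𝓡 d) (f i).symm)
    {R : ι → Set M} (hR : IsTopologicalPartition R)
    (hb : ∀ i, LebesgueNull d (frontier (R i))) :
    LebesgueAE d fun x : M => ∃ w, IsItinerary f R x w := by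
  -- `Z n` consists of the points that some word of length `n` carries outside `⋃ i, R i`. The
  -- complement of their union is forward invariant.
  let Z : ℕ → Set M := fun n => Nat.rec (⋃ i, R i)ᶜ (fun _ A => ⋃ i, (f i).symm '' A) n
  have hZ0 : LebesgueNull d (Z 0) := by
    refine LebesgueNull.mono (fun x hx => ?_) (LebesgueNull.iUnion hb)
    obtain ⟨i, hi⟩ := mem_iUnion.1 (hR.cover ▸ mem_univ x)
    refine mem_iUnion.2 ⟨i, hi, fun h => hx (mem_iUnion.2 ⟨i, interior_subset h⟩)⟩
  have hZ : ∀ n, LebesgueNull d (Z n) := by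
    intro n
    induction n with
    | zero => exact hZ0
    | succ n ih => exact LebesgueNull.iUnion fun i => ih.image K (hf i)
  refine LebesgueNull.mono (fun x hx => ?_) (LebesgueNull.iUnion hZ)
  by_contra hxZ
  refine hx (exists_isItinerary_of_forward_invariant (Y := (⋃ n, Z n)ᶜ) ?_ ?_ hxZ)
  · intro y hy i h
    obtain ⟨n, hn⟩ := mem_iUnion.1 h
    exact hy (mem_iUnion.2 ⟨n + 1, mem_iUnion.2 ⟨i, f i y, hn, by simp⟩⟩)
  · intro y hy
    by_contra h
    exact hy (mem_iUnion.2 ⟨0, h⟩)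

end Dynamics

/-! ### Exponents, generators and the choice of constants. -/

section Main

variable {d : ℕ} {M : Type*} [TopologicalSpace M]
    [ChartedSpace (EuclideanSpace ℝ (Fin d)) M]
    [RiemannianBundle (fun x : M => TangentSpace (𝓡 d) x)]

lemma log_normInvDeriv_le {g : M → M} {x : M} {σ : ℝ} (hσ : 0 < σ)
    (h : σ ≤ (normInvDeriv d g x)⁻¹) : Real.log (normInvDeriv d g x) ≤ -Real.log σ := by
  have := Real.log_le_log hσ h
  rw [Real.log_inv] at this
  linarith

lemma one_le_absDetDeriv {g : M → M} {x : M} (h : 1 ≤ (normInvDeriv d g x)⁻¹) :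
    1 ≤ absDetDeriv d g x :=
  one_le_absDet_of_one_le_inv_norm_inverse _ h

lemma upperExponent_le_of_eventually {ι : Type*} {f : ι → Equiv.Perm M} {w : ℕ → ι} {x : M}
    {c : ℝ} (h : ∀ᶠ n : ℕ in atTop, ∑ k ∈ Finset.range n,
      Real.log (normInvDeriv d (f (w k)) (fiberIterate f w k x)) ≤ -c * n) :
    upperExponent d f w x ≤ ((-c : ℝ) : EReal) := by
  refine limsup_le_of_le (h := ?_)
  filter_upwards [h, eventually_gt_atTop 0] with n hn h0
  have h0' : (0 : ℝ) < n := by exact_mod_cast h0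
  rw [EReal.coe_le_coe_iff, one_div, inv_mul_le_iff₀ h0']
  linarith

lemma fiberIterate_comp_index {X ι κ : Type*} {f : ι → Equiv.Perm X} {g : κ → Equiv.Perm X}
    {j : ι → κ} (h : ∀ i, g (j i) = f i) (w : ℕ → ι) (n : ℕ) :
    fiberIterate g (j ∘ w) n = fiberIterate f w n := by
  induction n with
  | zero => rfl
  | succ n ih =>
    funext x
    simp only [fiberIterate, Function.comp_apply, h]
    rw [ih]

lemma isOrbitalNonUniformlyExpanding_of_ae {G : Subsemigroup (Equiv.Perm M)}
    (hG : ∃ S : Set (Equiv.Perm M), S.Finite ∧ Subsemigroup.closure S = G)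
    {ι : Type*} [Finite ι] {f : ι → Equiv.Perm M} (hf : ∀ i, f i ∈ G) {c : ℝ} (hc : 0 < c)
    (h : LebesgueAE d fun x : M => ∃ w, upperExponent d f w x ≤ ((-c : ℝ) : EReal)) :
    IsOrbitalNonUniformlyExpanding d G := by
  obtain ⟨S, hS, hSG⟩ := hG
  -- Adding the `f i`, which lie in `G`, to the generators leaves the semigroup unchanged and makes
  -- words in `f` words in generators.
  let T := S ∪ range f
  have hT : Finite T := (hS.union (finite_range f)).to_subtype
  let e := Finite.equivFin T
  let j : ι → Fin (Nat.card T) := fun i => e ⟨f i, Or.inr ⟨i, rfl⟩⟩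
  let g : Fin (Nat.card T) → Equiv.Perm M := fun k => (e.symm k : T)
  have hj : ∀ i, g (j i) = f i := fun i => congrArg Subtype.val (e.symm_apply_apply _)
  have hg : range g = T := by
    have : g = Subtype.val ∘ e.symm := rfl
    rw [this, e.symm.surjective.range_comp, Subtype.range_coe]
  refine ⟨_, g, ?_, c, hc, LebesgueNull.mono (fun x hx => ?_) h⟩
  · rw [hg]
    refine le_antisymm (Subsemigroup.closure_le.2 (union_subset ?_ ?_)) ?_
    · exact hSG ▸ Subsemigroup.subset_closure
    · rintro _ ⟨i, rfl⟩
      exact hf i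
    · exact hSG ▸ Subsemigroup.closure_mono subset_union_left
  · rintro ⟨w, hw⟩
    refine hx ⟨j ∘ w, ?_⟩
    have : upperExponent d g (j ∘ w) x = upperExponent d f w x := by
      simp only [upperExponent, fiberIterate_comp_index hj, Function.comp_apply, hj]
    rwa [this]

end Main

/-- In each exponent the last `δ` is the rate `c`; the first `δ` of `δ + δ` bounds `log σ₂`. The
number `s` is fixed first, large enough to kill the `p` terms, and then `δ` is taken small by
continuity at `0`. -/
lemma exists_expansion_constants (p q : ℕ) {σ₁ κ : ℝ} (hσ₁ : 1 < σ₁) (hκ : (q : ℝ) < κ) :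
    ∃ s ≥ (0 : ℝ), ∃ δ > (0 : ℝ),
      p * Real.exp (s * (-Real.log σ₁ + δ)) + q * (κ⁻¹ * Real.exp (s * (δ + δ))) < 1 := by
  have hκ0 : 0 < κ := (Nat.cast_nonneg q).trans_lt hκ
  have hlog := Real.log_pos hσ₁
  have h1 : q * κ⁻¹ < 1 := by rw [← div_eq_mul_inv, div_lt_one hκ0]; exact hκ
  have h2 : Tendsto (fun s : ℝ => p * Real.exp (s * -Real.log σ₁) + q * κ⁻¹) atTop
      (𝓝 (p * 0 + q * κ⁻¹)) := by
    refine (Tendsto.const_mul _ (Real.tendsto_exp_atBot.comp ?_)).add tendsto_const_nhds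
    exact tendsto_id.atTop_mul_const_of_neg (by linarith)
  obtain ⟨s, hs, hs0⟩ := ((h2.eventually_lt_const (by simpa using h1)).and
    (eventually_ge_atTop 0)).exists
  refine ⟨s, hs0, ?_⟩
  have h3 : ContinuousAt (fun δ : ℝ => p * Real.exp (s * (-Real.log σ₁ + δ)) +
      q * (κ⁻¹ * Real.exp (s * (δ + δ)))) 0 := by fun_prop
  have h4 : ∀ᶠ δ in 𝓝[>] (0 : ℝ), p * Real.exp (s * (-Real.log σ₁ + δ)) +
      q * (κ⁻¹ * Real.exp (s * (δ + δ))) < 1 :=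
    (h3.tendsto.eventually_lt_const (by simpa using hs)).filter_mono nhdsWithin_le_nhds
  obtain ⟨δ, h5, h6⟩ := (h4.and self_mem_nhdsWithin).exists
  exact ⟨δ, h6, h5⟩

theorem mainTheorem2 {d : ℕ} {M : Type*} [EMetricSpace M] [CompactSpace M]
    [ChartedSpace (EuclideanSpace ℝ (Fin d)) M] [IsManifold (𝓡 d) ∞ M]
    [RiemannianBundle (fun x : M => TangentSpace (𝓡 d) x)]
    [IsContMDiffRiemannianBundle (𝓡 d) ∞ (EuclideanSpace ℝ (Fin d))
      (fun x : M => TangentSpace (𝓡 d) x)]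
    [IsRiemannianManifold (𝓡 d) M]
    (p q : ℕ) (σ₁ κ : ℝ) (hσ₁ : 1 < σ₁) (hκ : (q : ℝ) < κ) :
    ∃ σ_star : ℝ, 1 < σ_star ∧ ∀ (σ₂ : ℝ), 1 < σ₂ → σ₂ ≤ σ_star →
      ∀ (α : ℝ≥0), 0 < α → α ≤ 1 →
      ∀ (G : Subsemigroup (Equiv.Perm M)),
        (∃ S : Set (Equiv.Perm M), S.Finite ∧ Subsemigroup.closure S = G) →
        (∀ g ∈ G, IsC1HolderDiffeo d α g) →
      ∀ (f : Fin p ⊕ Fin q → Equiv.Perm M) (R : Fin p ⊕ Fin q → Set M),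
        (∀ i, f i ∈ G) →
        -- (A0)
        IsTopologicalPartition R →
        (∃ L : ℝ≥0, ∀ i, InnerDiameterLE (closure (R i)) L) →
        (∀ i, LebesgueNull d (frontier (R i))) →
        -- (A1)
        IsMarkov f R →
        -- (A2)
        (∀ i : Fin p, ∀ x ∈ R (Sum.inl i), σ₁ ≤ (normInvDeriv d (f (Sum.inl i)) x)⁻¹) →
        (∀ j : Fin q, ∀ x ∈ R (Sum.inr j), σ₂⁻¹ ≤ (normInvDeriv d (f (Sum.inr j)) x)⁻¹) →
        -- (A3)
        (∀ j : Fin q, ∀ x ∈ R (Sum.inr j), κ ≤ absDetDeriv d (f (Sum.inr j)) x) →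
        (∃ c : ℝ, 0 < c ∧ LebesgueAE d fun x : M =>
          ∃ w : ℕ → Fin p ⊕ Fin q, IsItinerary f R x w ∧
            upperExponent d f w x ≤ ((-c : ℝ) : EReal)) ∧
        IsOrbitalNonUniformlyExpanding d G := by
  obtain ⟨s, hs, δ, hδ, hθ⟩ := exists_expansion_constants p q hσ₁ hκ
  have hκ0 : 0 < κ := (Nat.cast_nonneg q).trans_lt hκ
  -- With this threshold `log σ₂ ≤ δ`, the value of `u` on the last `q` branches.
  refine ⟨Real.exp δ, Real.one_lt_exp_iff.2 hδ, ?_⟩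
  intro σ₂ hσ₂ hσ₂' α _ _ G hG hGd f R hfG hR _ hb _ hA hA' hdet
  have : IsContinuousRiemannianBundle (EuclideanSpace ℝ (Fin d))
      (fun x : M => TangentSpace (𝓡 d) x) := by
    obtain ⟨g, hg, h⟩ := IsContMDiffRiemannianBundle.exists_contMDiff (IB := 𝓡 d) (n := ∞)
      (F := EuclideanSpace ℝ (Fin d)) (E := fun x : M => TangentSpace (𝓡 d) x)
    exact ⟨⟨g, hg.continuous, h⟩⟩
  obtain ⟨K⟩ := nonempty_volumeAtlas (d := d) (M := M)
  have hf : ∀ i, MDifferentiable (𝓡 d) (𝓡 d) (f i) := fun i =>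
    (hGd _ (hfG i)).contMDiff.mdifferentiable one_ne_zero
  have hf' : ∀ i, MDifferentiable (𝓡 d) (𝓡 d) (f i).symm := fun i =>
    (hGd _ (hfG i)).contMDiff_symm.mdifferentiable one_ne_zero
  let l : Fin p ⊕ Fin q → ℝ := Sum.elim (fun _ => 1) (fun _ => κ)
  let u : Fin p ⊕ Fin q → ℝ := Sum.elim (fun _ => -Real.log σ₁) (fun _ => δ)
  have hl : ∀ i, 0 < l i := by rintro (i | j) <;> simp [l, hκ0]
  have hl' : ∀ i, ∀ x ∈ R i, l i ≤ absDetDeriv d (f i) x := by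
    rintro (i | j) x hx
    · exact one_le_absDetDeriv (hσ₁.le.trans (hA i x hx))
    · exact hdet j x hx
  have hu : ∀ i, ∀ x ∈ R i, Real.log (normInvDeriv d (f i) x) ≤ u i := by
    rintro (i | j) x hx
    · exact log_normInvDeriv_le (one_pos.trans hσ₁) (hA i x hx)
    · have h0 : 0 < σ₂ := one_pos.trans hσ₂
      refine (log_normInvDeriv_le (inv_pos.2 h0) (hA' j x hx)).trans ?_
      rw [Real.log_inv, neg_neg]
      exact (Real.log_le_iff_le_exp h0).2 hσ₂'
  have hθ' : ∑ᶠ i, (l i)⁻¹ * Real.exp (s * (u i + δ)) < 1 := by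
    rw [finsum_eq_sum_of_fintype, Fintype.sum_sum_type]
    simpa [l, u] using hθ
  have key := K.ae_eventually_sum_le hf hR.isOpen hl hl' u hs δ hθ'
  have hit := K.ae_exists_isItinerary hf' hR hb
  have main : LebesgueAE d fun x : M => ∃ w : ℕ → Fin p ⊕ Fin q, IsItinerary f R x w ∧
      upperExponent d f w x ≤ ((-δ : ℝ) : EReal) := by
    refine LebesgueNull.mono (fun x hx => ?_) (LebesgueNull.union key hit)
    by_contra hx'
    have h1 := not_not.1 fun h => hx' (Or.inl h)
    obtain ⟨w, hw⟩ := not_not.1 fun h => hx' (Or.inr h)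
    refine hx ⟨w, hw, upperExponent_le_of_eventually ?_⟩
    filter_upwards [h1 w hw] with n hn
    exact (Finset.sum_le_sum fun k _ => hu _ _ (hw k)).trans hn
  refine ⟨⟨δ, hδ, main⟩, isOrbitalNonUniformlyExpanding_of_ae hG hfG hδ
    (LebesgueNull.mono (fun x hx => ?_) main)⟩
  exact fun ⟨w, hw⟩ => hx ⟨w, hw.2⟩
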